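/- Consider the Gaussian linear regression model $y = X\beta + \epsilon$, where $X$ is a known $n \times p$ real matrix of rank $r$ any $r$ columns of which are linearly independent, $\beta \in \mathbb{R}^p$ is unknown, and $\epsilon \sim N(0, \sigma^2 I_n)$ with known $\sigma > 0$. Let $\Omega$ be a given set of admissible models, where a model is a subset $M$ of $\{1,\dots,p\}$. Let $m(k)$ be the number of models $M \in \Omega$ with $|M| = k$, and let $\mathfrak{M}_{k} = \{M \in \Omega : |M| \le k\}$. For a model $M$, $\beta_M$ denotes any vector of $\mathbb{R}^p$ whose set of indices of nonzero entries is exactly $M$. Let $\|\beta\|_0$ be the number of nonzero entries of $\beta$, and for $1 \le k \le r$ put $$\phi_{\min}[k] = \min_{1 \le \|\beta\|_0 \le k} \frac{\|X\beta\|^2}{\|\beta\|^2}, \qquad \phi_{\max}[k] = \max_{1 \le \|\beta\|_0 \le k} \frac{\|X\beta\|^2}{\|\beta\|^2}, \qquad \tau[k] = \frac{\phi_{\min}[k]}{\phi_{\max}[k]}.$$ There exists a universal constant $C > 0$ (independent of $n, p, X, \sigma, \Omega, p_0$) such that, for every $1 \le p_0 \le r$ with $m(p_0) \ge 1$, $$\inf_{\tilde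 y}\ \sup_{\beta_M :\, M \in \mathfrak{M}_{p_0}} \mathbb{E}\,\|\tilde y - X\beta_M\|^2 \ \ge\ \begin{cases} C\sigma^2 \max\left\{\tau[2p_0]\,\dfrac{\ln m(p_0)}{\max(1, \ln p_0)},\ \tau[p_0]\,p_0\right\}, & 1 \le p_0 \le r/2,\\[2mm] C\sigma^2\,\tau[p_0]\,r, & r/2 \le p_0 \le r,\end{cases}$$ where the infimum is over all estimators $\tilde y = \tilde y(y)$ of the mean vector $X\beta$, that is, all measurable functions from $\mathbb{R}^n$ to $\mathbb{R}^n$. (For $p_0 = r/2$ both bounds hold.) -/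

import Mathlib

open MeasureTheory ProbabilityTheory
open scoped ENNReal

noncomputable section

namespace SparseRegression

variable {n p : ℕ}

/-- The set of indices of the nonzero entries of a coefficient vector. -/
def supp (β : EuclideanSpace ℝ (Fin p)) : Finset (Fin p) :=
  Finset.univ.filter (fun j => β j ≠ 0)

/-- The `l₀` quasi-norm: the number of nonzero entries. -/
def l0 (β : EuclideanSpace ℝ (Fin p)) : ℕ := (supp β).card

/-- The mean vector `X β`, with Euclidean norms on both sides. -/
def meanVec (X : Matrix (Fin n) (Fin p) ℝ) (β : EuclideanSpace ℝ (Fin p)) :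
    EuclideanSpace ℝ (Fin n) :=
  Matrix.toEuclideanLin X β

/-- The quotients `‖Xβ‖² / ‖β‖²` over all `β` with `1 ≤ ‖β‖₀ ≤ k`. -/
def sparseQuotients (X : Matrix (Fin n) (Fin p) ℝ) (k : ℕ) : Set ℝ :=
  {q | ∃ β : EuclideanSpace ℝ (Fin p), 1 ≤ l0 β ∧ l0 β ≤ k ∧
    q = ‖meanVec X β‖ ^ 2 / ‖β‖ ^ 2}

/-- The `k`-sparse minimal eigenvalue of the design. -/
def phiMin (X : Matrix (Fin n) (Fin p) ℝ) (k : ℕ) : ℝ := sInf (sparseQuotients X k)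

/-- The `k`-sparse maximal eigenvalue of the design. -/
def phiMax (X : Matrix (Fin n) (Fin p) ℝ) (k : ℕ) : ℝ := sSup (sparseQuotients X k)

/-- The sparse eigenvalues ratio `τ[k]`. -/
def tau (X : Matrix (Fin n) (Fin p) ℝ) (k : ℕ) : ℝ := phiMin X k / phiMax X k

/-- The admissible models of size exactly `k`; `Ω` is the set of all admissible models, a model
being a set of predictors. -/
def modelsOfSize (Ω : Finset (Finset (Fin p))) (k : ℕ) : Finset (Finset (Fin p)) :=
  Ω.filter (fun M => M.card = k)

/-- `m(k)`, the number of admissible models of size `k`. -/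
def numModels (Ω : Finset (Finset (Fin p))) (k : ℕ) : ℕ := (modelsOfSize Ω k).card

/-- The admissible models with at most `k` predictors. -/
def modelsUpTo (Ω : Finset (Finset (Fin p))) (k : ℕ) : Finset (Finset (Fin p)) :=
  (Finset.range (k + 1)).biUnion (fun i => modelsOfSize Ω i)

/-- Coefficient vectors `β_M` of admissible models `M` of size at most `k`: the entry `j` of `β_M`
is nonzero if and only if `j` belongs to `M`. -/
def admissibleCoeffs (Ω : Finset (Finset (Fin p))) (k : ℕ) : Set (EuclideanSpace ℝ (Fin p)) :=
  {β | ∃ M ∈ modelsUpTo Ω k, ∀ j, β j ≠ 0 ↔ j ∈ M}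

/-- The law of `y = X β + ε` with `ε ∼ N(0, σ² Iₙ)`. -/
def obsLaw (X : Matrix (Fin n) (Fin p) ℝ) (σ : ℝ) (β : EuclideanSpace ℝ (Fin p)) :
    Measure (EuclideanSpace ℝ (Fin n)) :=
  multivariateGaussian (meanVec X β) (σ ^ 2 • (1 : Matrix (Fin n) (Fin n) ℝ))

/-- The quadratic risk `𝔼 ‖ỹ(y) - X β‖²` of an estimator `ỹ` of the mean vector, with value `∞`
if the expectation is infinite. -/
def risk (X : Matrix (Fin n) (Fin p) ℝ) (σ : ℝ)
    (est : EuclideanSpace ℝ (Fin n) → EuclideanSpace ℝ (Fin n))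
    (β : EuclideanSpace ℝ (Fin p)) : ℝ≥0∞ :=
  ∫⁻ y, ENNReal.ofReal (‖est y - meanVec X β‖ ^ 2) ∂(obsLaw X σ β)

/-- The minimax risk of estimating `X β` over the admissible models of size at most `k`: the
infimum is over all estimators, i.e. measurable functions of the observation `y`. -/
def minimaxRisk (X : Matrix (Fin n) (Fin p) ℝ) (σ : ℝ) (Ω : Finset (Finset (Fin p))) (k : ℕ) :
    ℝ≥0∞ :=
  ⨅ (est : EuclideanSpace ℝ (Fin n) → EuclideanSpace ℝ (Fin n)) (_ : Measurable est),
    ⨆ β ∈ admissibleCoeffs Ω k, risk X σ est β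

end SparseRegression

end

/-! Both lower bounds compare finitely many Gaussian means through the second moment of their
likelihood ratio, `exp (‖θ - η‖² / σ²)` (`gaussLaw_real_le`).

For the term `τ[p₀] p₀`, fix one admissible model of size `p₀` and take coefficients `±a` on it,
with `a²` of order `σ² / φ_max[p₀]`. One flipped sign is then hard to detect, and each misread sign
costs at least `φ_min[p₀] a²` (Assouad's argument, `exists_risk_ge_of_cube`). When `r ≤ 2 p₀` this
also gives the bound in `r`.

For the entropy term, take coefficients equal to `a` on a model. Squared distances are `a²` times
the size of a symmetric difference, and differences are `2 p₀`-sparse, whence `τ[2 p₀]`. Since `Ω`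
is arbitrary, it need not contain a large packing whose separation is comparable to its diameter.
But successive coverings through `O(max(1, ln p₀))` dyadic scales show that at some scale a ball
contains a packing, separated at half the radius, whose log-cardinality is at least `ln m(p₀)` over
the number of scales (`exists_local_packing`). A many-point argument applies there
(`exists_risk_ge_of_separated`); the choice of scale is what costs the denominator `max(1, ln p₀)`.
-/

namespace SparseRegression

variable {n p : ℕ}

/-! ### Gaussian laws, their densities and likelihood ratios -/

/-- The density of the centred Gaussian law with covariance `σ² Iₙ`. -/
noncomputable def gaussDensity (σ : ℝ) (y : EuclideanSpace ℝ (Fin n)) : ℝ :=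
  (2 * Real.pi * σ ^ 2) ^ (-(n : ℝ) / 2) * Real.exp (-(1 / (2 * σ ^ 2)) * ‖y‖ ^ 2)

lemma gaussDensity_nonneg {σ : ℝ} (hσ : 0 < σ) (y : EuclideanSpace ℝ (Fin n)) :
    0 ≤ gaussDensity σ y := by
  unfold gaussDensity; positivity

@[fun_prop]
lemma continuous_gaussDensity (σ : ℝ) :
    Continuous (gaussDensity (n := n) σ) := by
  unfold gaussDensity; fun_prop

lemma integral_cexp_mul_gaussDensity {σ : ℝ} (hσ : 0 < σ) (t : EuclideanSpace ℝ (Fin n)) :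
    ∫ y, Complex.exp (inner ℝ y t * Complex.I) * (gaussDensity σ y : ℂ)
      = Complex.exp (-(σ ^ 2 * ‖t‖ ^ 2 / 2)) := by
  have hb : (0 : ℝ) < ((1 / (2 * σ ^ 2) : ℝ) : ℂ).re := by
    rw [Complex.ofReal_re]; positivity
  have h := GaussianFourier.integral_cexp_neg_mul_sq_norm_add hb Complex.I t
  have e : ∀ y : EuclideanSpace ℝ (Fin n),
      Complex.exp (inner ℝ y t * Complex.I) * (gaussDensity σ y : ℂ)
      = (((2 * Real.pi * σ ^ 2) ^ (-(n : ℝ) / 2) : ℝ) : ℂ) *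
        Complex.exp (-((1 / (2 * σ ^ 2) : ℝ) : ℂ) * ‖y‖ ^ 2 + Complex.I * inner ℝ t y) := by
    intro y
    rw [gaussDensity, Complex.exp_add, real_inner_comm t y]
    push_cast
    ring_nf
  simp_rw [e]
  rw [integral_const_mul, h, ← mul_assoc]
  have hs : (0 : ℝ) < 2 * Real.pi * σ ^ 2 := by positivity
  have h1 : ((Real.pi : ℂ) / ((1 / (2 * σ ^ 2) : ℝ) : ℂ))
      = ((2 * Real.pi * σ ^ 2 : ℝ) : ℂ) := by
    have : (σ : ℂ) ≠ 0 := by exact_mod_cast hσ.ne'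
    push_cast; field_simp
  have h2 : ((Module.finrank ℝ (EuclideanSpace ℝ (Fin n)) : ℂ) / 2) = (((n : ℝ) / 2 : ℝ) : ℂ) := by
    simp
  rw [h1, h2, ← Complex.ofReal_cpow hs.le, ← Complex.ofReal_mul, ← Real.rpow_add hs]
  have h3 : -(n : ℝ) / 2 + (n : ℝ) / 2 = 0 := by ring
  rw [h3, Real.rpow_zero, Complex.ofReal_one, one_mul]
  congr 1
  have : (σ : ℂ) ≠ 0 := by exact_mod_cast hσ.ne'
  push_cast
  rw [Complex.I_sq]
  field_simp
  norm_num

lemma integrable_gaussDensity {σ : ℝ} (hσ : 0 < σ) :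
    Integrable (gaussDensity (n := n) σ) := by
  -- A non-integrable function has integral `0` by convention, while the Fourier formula at `t = 0`
  -- gives `1`.
  by_contra h
  have h1 := integral_cexp_mul_gaussDensity hσ (0 : EuclideanSpace ℝ (Fin n))
  simp only [inner_zero_right, Complex.ofReal_zero, zero_mul, Complex.exp_zero, one_mul,
    norm_zero] at h1
  rw [integral_complex_ofReal, integral_undef h] at h1
  simp at h1

/-- Two finite measures with the same characteristic function coincide. -/
lemma multivariateGaussian_zero_eq_withDensity {σ : ℝ} (hσ : 0 < σ) :
    multivariateGaussian (0 : EuclideanSpace ℝ (Fin n)) (σ ^ 2 • (1 : Matrix (Fin n) (Fin n) ℝ))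
      = volume.withDensity (fun y => ENNReal.ofReal (gaussDensity σ y)) := by
  have hfin : IsFiniteMeasure
      ((volume : Measure (EuclideanSpace ℝ (Fin n))).withDensity
        (fun y => ENNReal.ofReal (gaussDensity σ y))) :=
    isFiniteMeasure_withDensity_ofReal (integrable_gaussDensity hσ).2
  have hS : (σ ^ 2 • (1 : Matrix (Fin n) (Fin n) ℝ)).PosSemidef :=
    Matrix.PosSemidef.one.smul (sq_nonneg σ)
  apply Measure.ext_of_charFun
  ext t
  rw [charFun_multivariateGaussian hS, charFun_apply,
    integral_withDensity_eq_integral_toReal_smul (by fun_prop) (by simp)]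
  have e : ∀ y : EuclideanSpace ℝ (Fin n),
      (ENNReal.ofReal (gaussDensity σ y)).toReal • Complex.exp (inner ℝ y t * Complex.I)
      = Complex.exp (inner ℝ y t * Complex.I) * (gaussDensity σ y : ℂ) := by
    intro y
    rw [ENNReal.toReal_ofReal (gaussDensity_nonneg hσ y), Complex.real_smul, mul_comm]
  simp_rw [e]
  rw [integral_cexp_mul_gaussDensity hσ]
  congr 1
  have : (t.ofLp ⬝ᵥ (σ ^ 2 • (1 : Matrix (Fin n) (Fin n) ℝ)).mulVec t.ofLp) = σ ^ 2 * ‖t‖ ^ 2 := by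
    rw [Matrix.smul_mulVec, Matrix.one_mulVec, dotProduct_smul, EuclideanSpace.real_norm_sq_eq,
      dotProduct, smul_eq_mul]
    simp [sq]
  rw [this]
  simp

/-- The Gaussian law on `ℝⁿ` with covariance `σ² Iₙ` and a given mean. -/
noncomputable def gaussLaw (σ : ℝ) (θ : EuclideanSpace ℝ (Fin n)) :
    Measure (EuclideanSpace ℝ (Fin n)) :=
  multivariateGaussian θ (σ ^ 2 • (1 : Matrix (Fin n) (Fin n) ℝ))

instance (σ : ℝ) (θ : EuclideanSpace ℝ (Fin n)) : IsProbabilityMeasure (gaussLaw σ θ) := by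
  unfold gaussLaw; infer_instance

lemma gaussLaw_apply {σ : ℝ} (hσ : 0 < σ) (θ : EuclideanSpace ℝ (Fin n))
    {A : Set (EuclideanSpace ℝ (Fin n))} (hA : MeasurableSet A) :
    gaussLaw σ θ A = ∫⁻ y in A, ENNReal.ofReal (gaussDensity σ (y - θ)) := by
  have h : gaussLaw σ θ = (multivariateGaussian (0 : EuclideanSpace ℝ (Fin n))
      (σ ^ 2 • (1 : Matrix (Fin n) (Fin n) ℝ))).map (fun x => θ + x) := by
    rw [gaussLaw, multivariateGaussian, multivariateGaussian, Measure.map_map (by fun_prop)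
      (by fun_prop)]
    congr 1
    ext x
    simp
  rw [h, Measure.map_apply (by fun_prop) hA, multivariateGaussian_zero_eq_withDensity hσ,
    withDensity_apply _ ((by fun_prop : Measurable fun x => θ + x) hA),
    ← lintegral_indicator hA, ← lintegral_indicator ((by fun_prop : Measurable fun x => θ + x) hA),
    ← lintegral_add_left_eq_self (A.indicator fun y => ENNReal.ofReal (gaussDensity σ (y - θ))) θ]
  congr 1
  ext x
  simp only [Set.indicator, add_sub_cancel_left]
  rfl

/-- By the parallelogram law, `f_θ² / f_η` is `exp (‖θ - η‖² / σ²)` times the density centred at `2θ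
- η`. The bound is then AM-GM for `f_θ = √f_η · √(f_θ² / f_η)`, weighted by `t`. -/
lemma gaussDensity_sub_le {σ t : ℝ} (hσ : 0 < σ) (ht : 0 < t) (θ η y : EuclideanSpace ℝ (Fin n)) :
    gaussDensity σ (y - θ) ≤ t / 2 * gaussDensity σ (y - η) +
      Real.exp (‖θ - η‖ ^ 2 / σ ^ 2) / (2 * t) * gaussDensity σ (y - ((2 : ℝ) • θ - η)) := by
  have hpar : ‖y - η‖ ^ 2 + ‖y - ((2 : ℝ) • θ - η)‖ ^ 2
      = 2 * ‖y - θ‖ ^ 2 + 2 * ‖θ - η‖ ^ 2 := by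
    have h := parallelogram_law_with_norm ℝ (y - θ) (θ - η)
    have h1 : y - θ + (θ - η) = y - η := by abel
    have h2 : y - θ - (θ - η) = y - ((2 : ℝ) • θ - η) := by rw [two_smul]; abel
    rw [h1, h2] at h
    linarith [h]
  unfold gaussDensity
  set K := (2 * Real.pi * σ ^ 2) ^ (-(n : ℝ) / 2)
  have hK : 0 ≤ K := by positivity
  set u := Real.exp (-(1 / (2 * σ ^ 2)) * ‖y - η‖ ^ 2 / 2)
  set w := Real.exp (‖θ - η‖ ^ 2 / σ ^ 2 / 2 +
    (-(1 / (2 * σ ^ 2)) * ‖y - ((2 : ℝ) • θ - η)‖ ^ 2) / 2)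
  have e1 : Real.exp (-(1 / (2 * σ ^ 2)) * ‖y - η‖ ^ 2) = u ^ 2 := by
    rw [← Real.exp_nat_mul]; congr 1; push_cast; ring
  have e2 : Real.exp (‖θ - η‖ ^ 2 / σ ^ 2) *
      Real.exp (-(1 / (2 * σ ^ 2)) * ‖y - ((2 : ℝ) • θ - η)‖ ^ 2) = w ^ 2 := by
    rw [← Real.exp_nat_mul, ← Real.exp_add]; congr 1; push_cast; ring
  have e3 : Real.exp (-(1 / (2 * σ ^ 2)) * ‖y - θ‖ ^ 2) = u * w := by
    rw [← Real.exp_add]; congr 1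
    have : ‖y - θ‖ ^ 2 = (‖y - η‖ ^ 2 + ‖y - ((2 : ℝ) • θ - η)‖ ^ 2) / 2 - ‖θ - η‖ ^ 2 := by
      linarith
    rw [this]; field_simp; ring
  have key : u * w ≤ t / 2 * u ^ 2 + 1 / (2 * t) * w ^ 2 := by
    have : t / 2 * u ^ 2 + 1 / (2 * t) * w ^ 2 - u * w = (t * u - w) ^ 2 / (2 * t) := by
      field_simp; ring
    have h2 : 0 ≤ (t * u - w) ^ 2 / (2 * t) := by positivity
    linarith
  calc K * Real.exp (-(1 / (2 * σ ^ 2)) * ‖y - θ‖ ^ 2)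
      = K * (u * w) := by rw [e3]
    _ ≤ K * (t / 2 * u ^ 2 + 1 / (2 * t) * w ^ 2) := by gcongr
    _ = _ := by rw [← e2, e1]; ring

/-- Comparison of the probabilities of an event under two Gaussian laws, with the second moment of
their likelihood ratio. -/
lemma gaussLaw_real_le {σ t : ℝ} (hσ : 0 < σ) (ht : 0 < t) (θ η : EuclideanSpace ℝ (Fin n))
    {A : Set (EuclideanSpace ℝ (Fin n))} (hA : MeasurableSet A) :
    (gaussLaw σ θ).real A ≤ t / 2 * (gaussLaw σ η).real A +
      Real.exp (‖θ - η‖ ^ 2 / σ ^ 2) / (2 * t) := by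
  have hle : gaussLaw σ θ A ≤ ENNReal.ofReal (t / 2) * gaussLaw σ η A +
      ENNReal.ofReal (Real.exp (‖θ - η‖ ^ 2 / σ ^ 2) / (2 * t)) *
        gaussLaw σ ((2 : ℝ) • θ - η) A := by
    rw [gaussLaw_apply hσ _ hA, gaussLaw_apply hσ _ hA, gaussLaw_apply hσ _ hA,
      ← lintegral_const_mul _ (by fun_prop), ← lintegral_const_mul _ (by fun_prop),
      ← lintegral_add_left (by fun_prop)]
    refine lintegral_mono fun y => ?_
    rw [← ENNReal.ofReal_mul (by positivity), ← ENNReal.ofReal_mul (by positivity),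
      ← ENNReal.ofReal_add
        (mul_nonneg (by positivity) (gaussDensity_nonneg hσ _))
        (mul_nonneg (by positivity) (gaussDensity_nonneg hσ _))]
    exact ENNReal.ofReal_le_ofReal (gaussDensity_sub_le hσ ht θ η y)
  have h1 : gaussLaw σ ((2 : ℝ) • θ - η) A ≤ 1 := prob_le_one
  have hle2 : gaussLaw σ θ A ≤ ENNReal.ofReal (t / 2) * gaussLaw σ η A +
      ENNReal.ofReal (Real.exp (‖θ - η‖ ^ 2 / σ ^ 2) / (2 * t)) :=
    hle.trans (by gcongr; exact mul_le_of_le_one_right' h1)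
  have h3 := ENNReal.toReal_mono (by finiteness) hle2
  rw [ENNReal.toReal_add (by finiteness) (by finiteness), ENNReal.toReal_mul,
    ENNReal.toReal_ofReal (by positivity), ENNReal.toReal_ofReal (by positivity)] at h3
  exact h3

/-! ### Many-point and hypercube lower bounds -/

/-- Many-point lower bound: among at least two `2ρ`-separated means that are close to a common
centre, some mean is estimated with risk at least `ρ² / 8`. -/
lemma exists_risk_ge_of_separated {σ ρ : ℝ} (hσ : 0 < σ) (hρ : 0 ≤ ρ) {ι : Type*} (s : Finset ι)
    (θ : ι → EuclideanSpace ℝ (Fin n)) (θ₀ : EuclideanSpace ℝ (Fin n)) (hs : 2 ≤ s.card)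
    (hsep : ∀ i ∈ s, ∀ j ∈ s, i ≠ j → 2 * ρ ≤ ‖θ i - θ j‖)
    (hclose : ∀ i ∈ s, ‖θ i - θ₀‖ ^ 2 / σ ^ 2 ≤ Real.log s.card / 2)
    {est : EuclideanSpace ℝ (Fin n) → EuclideanSpace ℝ (Fin n)} (hest : Measurable est) :
    ∃ i ∈ s, ENNReal.ofReal (ρ ^ 2 / 8) ≤
      ∫⁻ y, ENNReal.ofReal (‖est y - θ i‖ ^ 2) ∂(gaussLaw σ (θ i)) := by
  set N : ℝ := (s.card : ℝ) with hN
  have hN2 : (2 : ℝ) ≤ N := by rw [hN]; exact_mod_cast hs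
  have hN0 : 0 < N := by linarith
  set A : ι → Set (EuclideanSpace ℝ (Fin n)) := fun i => {y | ‖est y - θ i‖ < ρ} with hA
  have hAm : ∀ i, MeasurableSet (A i) := fun i =>
    measurableSet_lt (by fun_prop) measurable_const
  have hdisj : (s : Set ι).PairwiseDisjoint A := by
    intro i hi j hj hij
    refine Set.disjoint_left.2 fun y hyi hyj => ?_
    have h1 : ‖est y - θ i‖ < ρ := hyi
    have h2 : ‖est y - θ j‖ < ρ := hyj
    have h3 := hsep i hi j hj hij
    have h4 : ‖θ i - θ j‖ ≤ ‖est y - θ i‖ + ‖est y - θ j‖ := by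
      have : θ i - θ j = (est y - θ j) - (est y - θ i) := by abel
      rw [this, add_comm]
      exact norm_sub_le _ _
    linarith
  have hsq : Real.sqrt N * Real.sqrt N = N := Real.mul_self_sqrt hN0.le
  have hsum : ∑ i ∈ s, (gaussLaw σ (θ i)).real (A i) ≤ ∑ _i ∈ s, (7 / 8 : ℝ) := by
    have h0 : ∑ i ∈ s, (gaussLaw σ θ₀).real (A i) ≤ 1 := by
      rw [← measureReal_biUnion_finset hdisj (fun i _ => hAm i)]
      exact measureReal_le_one
    -- With `t = N` and disjoint events, the sum is at most `N / 2 + √N / 2`, which is at most `7 N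
    -- / 8` once `N ≥ 2`.
    have h1 : ∀ i ∈ s, (gaussLaw σ (θ i)).real (A i) ≤
        N / 2 * (gaussLaw σ θ₀).real (A i) + Real.sqrt N / (2 * N) := by
      intro i hi
      refine (gaussLaw_real_le hσ hN0 (θ i) θ₀ (hAm i)).trans ?_
      gcongr
      calc Real.exp (‖θ i - θ₀‖ ^ 2 / σ ^ 2) ≤ Real.exp (Real.log N / 2) :=
            Real.exp_le_exp.2 (hclose i hi)
        _ = Real.sqrt N := by rw [← Real.log_sqrt hN0.le, Real.exp_log (Real.sqrt_pos.2 hN0)]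
    refine (Finset.sum_le_sum h1).trans ?_
    rw [Finset.sum_add_distrib, ← Finset.mul_sum, Finset.sum_const, Finset.sum_const,
      nsmul_eq_mul, nsmul_eq_mul, ← hN]
    have h2 : N * (Real.sqrt N / (2 * N)) = Real.sqrt N / 2 := by field_simp
    have h3 : Real.sqrt N ≤ 3 / 4 * N := by
      rw [Real.sqrt_le_left (by positivity)]
      nlinarith
    rw [h2]
    nlinarith
  obtain ⟨i, hi, hle⟩ := Finset.exists_le_of_sum_le (Finset.card_pos.1 (by omega)) hsum
  refine ⟨i, hi, ?_⟩
  have hc : (1 / 8 : ℝ) ≤ (gaussLaw σ (θ i)).real (A i)ᶜ := by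
    rw [probReal_compl_eq_one_sub (hAm i)]; linarith
  have hm : ENNReal.ofReal (ρ ^ 2) * gaussLaw σ (θ i) (A i)ᶜ ≤
      ∫⁻ y, ENNReal.ofReal (‖est y - θ i‖ ^ 2) ∂(gaussLaw σ (θ i)) := by
    rw [← lintegral_indicator_const (hAm i).compl]
    refine lintegral_mono fun y => ?_
    by_cases hy : y ∈ (A i)ᶜ
    · rw [Set.indicator_of_mem hy]
      have : ρ ≤ ‖est y - θ i‖ := not_lt.1 hy
      exact ENNReal.ofReal_le_ofReal (by gcongr)
    · rw [Set.indicator_of_notMem hy]; exact zero_le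
  refine le_trans ?_ hm
  rw [← ofReal_measureReal, ← ENNReal.ofReal_mul (by positivity)]
  exact ENNReal.ofReal_le_ofReal (by nlinarith [sq_nonneg ρ])

/-- `B` is the orthogonal projection onto the range of `L` followed by the inverse of `L`; the
projection fixes `L v` and is a contraction. This turns an estimator of the mean into one of the
coordinates. -/
lemma exists_measurable_coords {ι : Type*} [Fintype ι]
    (L : EuclideanSpace ℝ ι →ₗ[ℝ] EuclideanSpace ℝ (Fin n)) {c : ℝ} (hc : 0 < c)
    (hL : ∀ v, c * ‖v‖ ^ 2 ≤ ‖L v‖ ^ 2) :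
    ∃ B : EuclideanSpace ℝ (Fin n) → EuclideanSpace ℝ ι, Measurable B ∧
      ∀ x v, c * ‖B x - v‖ ^ 2 ≤ ‖x - L v‖ ^ 2 := by
  have hinj : Function.Injective L := by
    rw [injective_iff_map_eq_zero]
    intro v hv
    have h := hL v
    rw [hv, norm_zero] at h
    have : ‖v‖ ^ 2 ≤ 0 := by nlinarith [sq_nonneg ‖v‖]
    exact norm_eq_zero.1 (pow_eq_zero_iff (two_ne_zero)|>.1 (le_antisymm this (sq_nonneg _)))
  let e := LinearEquiv.ofInjective L hinj
  let B : EuclideanSpace ℝ (Fin n) →ₗ[ℝ] EuclideanSpace ℝ ι :=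
    e.symm.toLinearMap ∘ₗ (L.range.orthogonalProjectionOnto : _ →L[ℝ] L.range).toLinearMap
  have hB : ∀ x, L (B x) = L.range.starProjection x := by
    intro x
    have h1 : (e (e.symm (L.range.orthogonalProjectionOnto x)) : EuclideanSpace ℝ (Fin n))
      = L.range.starProjection x := by
      rw [LinearEquiv.apply_symm_apply]; rfl
    rw [← h1]; rfl
  refine ⟨B, (LinearMap.continuous_of_finiteDimensional B).measurable, fun x v => ?_⟩
  refine (hL _).trans ?_
  rw [map_sub, hB]
  have h2 : L.range.starProjection x - L v = L.range.starProjection (x - L v) := by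
    rw [map_sub, Submodule.starProjection_eq_self_iff.2 (LinearMap.mem_range_self L v)]
  rw [h2]
  gcongr
  exact Submodule.norm_starProjection_apply_le _ _

/-- The vertices of the cube with side `2a`. -/
noncomputable def cubeVertex {ι : Type*} (a : ℝ) (ω : ι → Bool) : EuclideanSpace ℝ ι :=
  WithLp.toLp 2 fun i => if ω i then a else -a

lemma norm_cubeVertex_sub_update_sq {ι : Type*} [Fintype ι] [DecidableEq ι] (a : ℝ) (ω : ι → Bool)
    (i : ι) :
    ‖cubeVertex a ω - cubeVertex a (Function.update ω i (!ω i))‖ ^ 2 = 4 * a ^ 2 := by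
  rw [EuclideanSpace.real_norm_sq_eq, Finset.sum_eq_single i]
  · cases h : ω i <;> simp [cubeVertex, h] <;> ring
  · intro j _ hj
    simp [cubeVertex, hj]
  · simp

/-- Hypercube lower bound: some vertex of a small cube is estimated with a risk proportional to the
dimension of the cube. -/
lemma exists_risk_ge_of_cube {σ a c : ℝ} (hσ : 0 < σ) (ha : 0 ≤ a) (hc : 0 < c) {ι : Type*}
    [Fintype ι] (L : EuclideanSpace ℝ ι →ₗ[ℝ] EuclideanSpace ℝ (Fin n))
    (hL : ∀ v, c * ‖v‖ ^ 2 ≤ ‖L v‖ ^ 2)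
    (hclose : ∀ v, ‖v‖ ^ 2 = 4 * a ^ 2 → ‖L v‖ ^ 2 / σ ^ 2 ≤ 1 / 2)
    {est : EuclideanSpace ℝ (Fin n) → EuclideanSpace ℝ (Fin n)} (hest : Measurable est) :
    ∃ ω : ι → Bool, ENNReal.ofReal (c * a ^ 2 * (Fintype.card ι / 4)) ≤
      ∫⁻ y, ENNReal.ofReal (‖est y - L (cubeVertex a ω)‖ ^ 2)
        ∂(gaussLaw σ (L (cubeVertex a ω))) := by
  classical
  obtain ⟨B, hBm, hB⟩ := exists_measurable_coords L hc hL
  -- The event that the sign of coordinate `i` is misread. Zero counts as negative, so that flipping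
  -- `ω i` gives exactly the complement.
  set W : (ι → Bool) → ι → Set (EuclideanSpace ℝ (Fin n)) := fun ω i =>
    if ω i then {y | B (est y) i ≤ 0} else {y | 0 < B (est y) i} with hW
  have hcoord : ∀ i, Measurable fun y => B (est y) i := fun i => by fun_prop
  have hWm : ∀ ω i, MeasurableSet (W ω i) := by
    intro ω i
    simp only [hW]
    split_ifs
    · exact measurableSet_le (hcoord i) measurable_const
    · exact measurableSet_lt measurable_const (hcoord i)
  set flip : ι → (ι → Bool) → (ι → Bool) := fun i ω => Function.update ω i (!ω i) with hflip
  have hinv : ∀ i, Function.Involutive (flip i) := by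
    intro i ω
    simp [hflip]
  have hWflip : ∀ ω i, W (flip i ω) i = (W ω i)ᶜ := by
    intro ω i
    ext y
    cases h : ω i <;> simp [hW, hflip, h]
  set q : (ι → Bool) → ι → ℝ := fun ω i => (gaussLaw σ (L (cubeVertex a ω))).real (W ω i) with hq
  have hpair : ∀ ω i, 1 / 2 ≤ q ω i + q (flip i ω) i := by
    intro ω i
    -- With `t = 2` the two probabilities of the same event differ by at most `1 / 2`, so the two
    -- error probabilities sum to at least `1 / 2`.
    have h1 := gaussLaw_real_le hσ two_pos (L (cubeVertex a (flip i ω))) (L (cubeVertex a ω))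
      (hWm ω i)
    have h2 : Real.exp (‖L (cubeVertex a (flip i ω)) - L (cubeVertex a ω)‖ ^ 2 / σ ^ 2) ≤ 2 := by
      rw [← map_sub]
      have h3 := hclose (cubeVertex a (flip i ω) - cubeVertex a ω) (by
        rw [norm_sub_rev]; exact norm_cubeVertex_sub_update_sq a ω i)
      calc _ ≤ Real.exp (Real.log 2) :=
            Real.exp_le_exp.2 (h3.trans (by have := Real.log_two_gt_d9; linarith))
        _ = 2 := Real.exp_log two_pos
    have h4 : q (flip i ω) i = 1 - (gaussLaw σ (L (cubeVertex a (flip i ω)))).real (W ω i) := by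
      rw [← probReal_compl_eq_one_sub (hWm ω i), ← hWflip]
    have h5 : Real.exp (‖L (cubeVertex a (flip i ω)) - L (cubeVertex a ω)‖ ^ 2 / σ ^ 2) / (2 * 2)
      ≤ 1 / 2 := by linarith
    rw [h4]
    change 1 / 2 ≤ (gaussLaw σ (L (cubeVertex a ω))).real (W ω i) + _
    linarith
  have hsum : ∑ _ω : ι → Bool, ((Fintype.card ι : ℝ) / 4) ≤ ∑ ω : ι → Bool, ∑ i, q ω i := by
    rw [Finset.sum_comm]
    have h1 : ∀ i, ∑ _ω : ι → Bool, (1 / 4 : ℝ) ≤ ∑ ω, q ω i := by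
      intro i
      have h2 : ∑ ω, q (flip i ω) i = ∑ ω, q ω i :=
        Equiv.sum_comp (hinv i).toPerm (fun ω => q ω i)
      have h3 : ∑ _ω : ι → Bool, (1 / 2 : ℝ) ≤ ∑ ω, (q ω i + q (flip i ω) i) :=
        Finset.sum_le_sum fun ω _ => hpair ω i
      rw [Finset.sum_add_distrib, h2] at h3
      rw [Finset.sum_const, nsmul_eq_mul] at h3 ⊢
      linarith
    refine le_trans (le_of_eq ?_) (Finset.sum_le_sum fun i _ => h1 i)
    simp only [Finset.sum_const, nsmul_eq_mul, Finset.card_univ]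
    ring
  obtain ⟨ω, -, hω⟩ := Finset.exists_le_of_sum_le Finset.univ_nonempty hsum
  refine ⟨ω, ?_⟩
  have hpt : ∀ y, ∑ i, (W ω i).indicator (fun _ => ENNReal.ofReal (c * a ^ 2)) y ≤
      ENNReal.ofReal (‖est y - L (cubeVertex a ω)‖ ^ 2) := by
    intro y
    -- A misread sign puts the estimated coordinate at distance at least `a` from the true one.
    have h1 : ∀ i, (W ω i).indicator (fun _ => ENNReal.ofReal (c * a ^ 2)) y ≤
        ENNReal.ofReal (c * (B (est y) - cubeVertex a ω) i ^ 2) := by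
      intro i
      by_cases hy : y ∈ W ω i
      · rw [Set.indicator_of_mem hy]
        apply ENNReal.ofReal_le_ofReal
        refine mul_le_mul_of_nonneg_left ?_ hc.le
        cases h : ω i
        · have hy' : 0 < B (est y) i := by simpa [hW, h] using hy
          simp only [cubeVertex, PiLp.sub_apply, h]
          simp only [Bool.false_eq_true, if_false]
          nlinarith
        · have hy' : B (est y) i ≤ 0 := by simpa [hW, h] using hy
          simp only [cubeVertex, PiLp.sub_apply, h, if_true]
          nlinarith
      · rw [Set.indicator_of_notMem hy]; exact zero_le
    refine (Finset.sum_le_sum fun i _ => h1 i).trans ?_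
    rw [← ENNReal.ofReal_sum_of_nonneg (fun i _ => by positivity), ← Finset.mul_sum,
      ← EuclideanSpace.real_norm_sq_eq]
    exact ENNReal.ofReal_le_ofReal (hB _ _)
  refine le_trans ?_ (lintegral_mono hpt)
  rw [lintegral_finsetSum _ (fun i _ => measurable_const.indicator (hWm ω i))]
  simp_rw [lintegral_indicator_const (hWm ω _)]
  rw [← Finset.mul_sum, ENNReal.ofReal_mul (by positivity)]
  gcongr
  have h2 : ∀ i, gaussLaw σ (L (cubeVertex a ω)) (W ω i) = ENNReal.ofReal (q ω i) := fun i =>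
    (ofReal_measureReal (h := measure_ne_top _ _)).symm
  simp_rw [h2]
  rw [← ENNReal.ofReal_sum_of_nonneg (fun i _ => measureReal_nonneg)]
  exact ENNReal.ofReal_le_ofReal hω

/-! ### Local packings in finite metric spaces -/

/-- A maximal separated subset is a covering net. -/
lemma exists_separated_net {α : Type*} [DecidableEq α] (d : α → α → ℕ)
    (hsymm : ∀ x y, d x y = d y x) (S : Finset α) (δ : ℕ) :
    ∃ T ⊆ S, (∀ x ∈ T, ∀ y ∈ T, x ≠ y → δ < d x y) ∧ ∀ x ∈ S, x ∈ T ∨ ∃ t ∈ T, d t x ≤ δ := by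
  have hne : (S.powerset.filter fun T => ∀ x ∈ T, ∀ y ∈ T, x ≠ y → δ < d x y).Nonempty :=
    ⟨∅, by simp⟩
  obtain ⟨T, hT, hmax⟩ := Finset.exists_max_image _ Finset.card hne
  rw [Finset.mem_filter, Finset.mem_powerset] at hT
  refine ⟨T, hT.1, hT.2, fun x hx => ?_⟩
  by_contra! hcon
  obtain ⟨hxT, hfar⟩ := hcon
  have h1 := hmax (insert x T) (by
    rw [Finset.mem_filter, Finset.mem_powerset]
    refine ⟨Finset.insert_subset hx hT.1, fun u hu v hv huv => ?_⟩
    rw [Finset.mem_insert] at hu hv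
    rcases hu with rfl | hu <;> rcases hv with rfl | hv
    · exact absurd rfl huv
    · rw [hsymm]; exact hfar v hv
    · exact hfar u hu
    · exact hT.2 u hu v hv huv)
  rw [Finset.card_insert_of_notMem hxT] at h1
  omega

/-- A maximal `2 ^ j`-separated subset of a ball of radius `2 ^ (j + 1)` has at most `b` points and
covers it by balls of half the radius. The recursion ends at radius `1`, where `hd` leaves a single
point. -/
lemma card_le_pow_of_local_packing_le {α : Type*} [DecidableEq α] (d : α → α → ℕ)
    (hsymm : ∀ x y, d x y = d y x) (hself : ∀ x, d x x = 0) (F : Finset α)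
    (hd : ∀ x ∈ F, ∀ y ∈ F, d x y ≤ 1 → x = y)
    (b : ℕ)
    (hb : ∀ j, ∀ c ∈ F, ∀ T ⊆ F, (∀ x ∈ T, d c x ≤ 2 ^ (j + 1)) →
      (∀ x ∈ T, ∀ y ∈ T, x ≠ y → 2 ^ j < d x y) → T.card ≤ b) (j : ℕ) :
    ∀ c ∈ F, ∀ S ⊆ F, (∀ x ∈ S, d c x ≤ 2 ^ j) → S.card ≤ b ^ j := by
  induction j with
  | zero =>
    intro c hc S hS hball
    rw [pow_zero]
    refine Finset.card_le_one.2 fun x hx y hy => ?_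
    rw [← hd c hc x (hS hx) (by simpa using hball x hx),
      ← hd c hc y (hS hy) (by simpa using hball y hy)]
  | succ j ih =>
    intro c hc S hS hball
    obtain ⟨T, hTS, hsep, hnet⟩ := exists_separated_net d hsymm S (2 ^ j)
    have hT := hb j c hc T (hTS.trans hS) (fun x hx => hball x (hTS hx)) hsep
    have hcov : S ⊆ T.biUnion fun t => S.filter fun x => d t x ≤ 2 ^ j := by
      intro x hx
      rw [Finset.mem_biUnion]
      rcases hnet x hx with h | ⟨t, ht, htx⟩
      · exact ⟨x, h, Finset.mem_filter.2 ⟨hx, by rw [hself]; exact Nat.zero_le _⟩⟩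
      · exact ⟨t, ht, Finset.mem_filter.2 ⟨hx, htx⟩⟩
    calc S.card ≤ _ := Finset.card_le_card hcov
      _ ≤ T.card * b ^ j := Finset.card_biUnion_le_card_mul _ _ _ fun t ht =>
          ih t (hS (hTS ht)) _ ((Finset.filter_subset _ _).trans hS)
            fun x hx => (Finset.mem_filter.1 hx).2
      _ ≤ b * b ^ j := by gcongr
      _ = b ^ (j + 1) := by ring

/-- A finite metric space of diameter at most `2 ^ J` has a ball with a large local packing. -/
lemma exists_local_packing {α : Type*} [DecidableEq α] (d : α → α → ℕ)
    (hsymm : ∀ x y, d x y = d y x) (hself : ∀ x, d x x = 0) (F : Finset α) (hF : F.Nonempty)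
    (hd : ∀ x ∈ F, ∀ y ∈ F, d x y ≤ 1 → x = y) {J : ℕ} (hJ : J ≠ 0)
    (hdiam : ∀ x ∈ F, ∀ y ∈ F, d x y ≤ 2 ^ J) :
    ∃ j, ∃ c ∈ F, ∃ T ⊆ F, (∀ x ∈ T, d c x ≤ 2 ^ (j + 1)) ∧
      (∀ x ∈ T, ∀ y ∈ T, x ≠ y → 2 ^ j < d x y) ∧
      Real.log F.card / J ≤ Real.log T.card ∧ T.Nonempty := by
  by_contra! hcon
  set R := Real.exp (Real.log F.card / J) with hR
  have hR0 : 0 < R := Real.exp_pos _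
  -- The largest integer strictly below `R`: were every local packing smaller than `R`, then `|F| ≤
  -- b ^ J < R ^ J = |F|`.
  set b := ⌈R⌉₊ - 1 with hbdef
  have hceil : 0 < ⌈R⌉₊ := Nat.ceil_pos.2 hR0
  have hbR : (b : ℝ) < R := Nat.lt_ceil.1 (by omega)
  obtain ⟨c, hc⟩ := hF
  have hle := card_le_pow_of_local_packing_le d hsymm hself F hd b (fun j c hc T hT h1 h2 => by
    rcases T.eq_empty_or_nonempty with h0 | h0
    · simp [h0]
    · have h3 : Real.log T.card < Real.log F.card / J := by
        by_contra! h4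
        exact h0.ne_empty (hcon j c hc T hT h1 h2 h4)
      have h5 : (T.card : ℝ) < R := by
        rw [← Real.exp_log (Nat.cast_pos.2 (Finset.card_pos.2 h0) : (0 : ℝ) < T.card)]
        exact Real.exp_lt_exp.2 h3
      have := Nat.lt_ceil.2 h5
      omega) J c hc F subset_rfl (hdiam c hc)
  have hFpos : (0 : ℝ) < F.card := Nat.cast_pos.2 (Finset.card_pos.2 ⟨c, hc⟩)
  have h1 : (F.card : ℝ) ≤ (b : ℝ) ^ J := by exact_mod_cast hle
  have h2 : (b : ℝ) ^ J < R ^ J := pow_lt_pow_left₀ hbR (Nat.cast_nonneg _) hJ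
  have h3 : R ^ J = F.card := by
    rw [hR, ← Real.exp_nat_mul, mul_div_cancel₀ _ (by exact_mod_cast hJ), Real.exp_log hFpos]
  linarith

/-- For sets of equal size the two halves of the symmetric difference have equal size, so its
cardinality is even. -/
lemma eq_of_card_eq_of_card_symmDiff_le_one {α : Type*} [DecidableEq α] {M M' : Finset α}
    (h : M.card = M'.card) (hd : (symmDiff M M').card ≤ 1) : M = M' := by
  have h1 : (symmDiff M M').card = (M \ M').card + (M' \ M).card :=
    Finset.card_union_of_disjoint disjoint_sdiff_sdiff
  have h2 := Finset.card_sdiff_add_card_inter M M'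
  have h3 := Finset.card_sdiff_add_card_inter M' M
  rw [Finset.inter_comm] at h3
  have h4 : (M \ M').card = 0 := by omega
  exact Finset.eq_of_subset_of_card_le (Finset.sdiff_eq_empty_iff_subset.1 (Finset.card_eq_zero.1 h4))
    h.ge

lemma clog_two_mul_le {k : ℕ} (hk : 1 ≤ k) :
    (Nat.clog 2 (2 * k) : ℝ) ≤ 4 * max 1 (Real.log k) := by
  have h1 : 2 ^ (Nat.clog 2 (2 * k) - 1) < 2 * k :=
    Nat.pow_pred_clog_lt_self one_lt_two (by omega)
  have hpos : 0 < Nat.clog 2 (2 * k) := Nat.clog_pos one_lt_two (by omega)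
  obtain ⟨J, hJ⟩ : ∃ J, Nat.clog 2 (2 * k) = J + 1 := ⟨_, (Nat.succ_pred_eq_of_pos hpos).symm⟩
  rw [hJ] at h1 ⊢
  have hk0 : (0 : ℝ) < k := by exact_mod_cast hk
  have h2 : ((2 : ℝ) ^ J) < 2 * k := by exact_mod_cast h1
  have h3 := Real.log_lt_log (by positivity) h2
  rw [Real.log_pow, Real.log_mul two_ne_zero hk0.ne'] at h3
  have h4 := Real.log_two_gt_d9
  have h5 := le_max_left 1 (Real.log k)
  have h6 := le_max_right 1 (Real.log k)
  push_cast
  have h7 : ((J : ℝ) - 1) * Real.log 2 ≤ max 1 (Real.log k) := by linarith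
  rcases Nat.eq_zero_or_pos J with h0 | h0
  · rw [h0]; push_cast; linarith
  · have h8 : (1 : ℝ) ≤ J := by exact_mod_cast h0
    nlinarith

/-! ### Sparse eigenvalues and the minimax risk -/

lemma meanVec_sub (X : Matrix (Fin n) (Fin p) ℝ) (β β' : EuclideanSpace ℝ (Fin p)) :
    meanVec X β - meanVec X β' = meanVec X (β - β') := by
  simp [meanVec]

lemma sparseQuotients_nonneg (X : Matrix (Fin n) (Fin p) ℝ) (k : ℕ) :
    ∀ q ∈ sparseQuotients X k, 0 ≤ q := by
  rintro q ⟨β, -, -, rfl⟩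
  positivity

lemma bddAbove_sparseQuotients (X : Matrix (Fin n) (Fin p) ℝ) (k : ℕ) :
    BddAbove (sparseQuotients X k) := by
  set T := LinearMap.toContinuousLinearMap (Matrix.toEuclideanLin X)
  refine ⟨‖T‖ ^ 2, ?_⟩
  rintro q ⟨β, -, -, rfl⟩
  have h : ‖meanVec X β‖ ≤ ‖T‖ * ‖β‖ := T.le_opNorm β
  refine div_le_of_le_mul₀ (sq_nonneg _) (sq_nonneg _) ?_
  rw [← mul_pow]
  gcongr

lemma phiMin_nonneg (X : Matrix (Fin n) (Fin p) ℝ) (k : ℕ) : 0 ≤ phiMin X k :=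
  Real.sInf_nonneg (sparseQuotients_nonneg X k)

lemma phiMax_nonneg (X : Matrix (Fin n) (Fin p) ℝ) (k : ℕ) : 0 ≤ phiMax X k :=
  Real.sSup_nonneg (sparseQuotients_nonneg X k)

lemma quotient_mem {X : Matrix (Fin n) (Fin p) ℝ} {k : ℕ} {β : EuclideanSpace ℝ (Fin p)}
    (hk : l0 β ≤ k) (hβ : β ≠ 0) : ‖meanVec X β‖ ^ 2 / ‖β‖ ^ 2 ∈ sparseQuotients X k := by
  refine ⟨β, ?_, hk, rfl⟩
  rw [l0, Nat.one_le_iff_ne_zero, ← Nat.pos_iff_ne_zero, Finset.card_pos]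
  by_contra h
  refine hβ (PiLp.ext fun j => ?_)
  by_contra hj
  exact h ⟨j, by simpa [supp] using hj⟩

lemma phiMin_mul_le {X : Matrix (Fin n) (Fin p) ℝ} {k : ℕ} {β : EuclideanSpace ℝ (Fin p)}
    (hk : l0 β ≤ k) : phiMin X k * ‖β‖ ^ 2 ≤ ‖meanVec X β‖ ^ 2 := by
  rcases eq_or_ne β 0 with rfl | hβ
  · simp [meanVec]
  · have hpos : 0 < ‖β‖ ^ 2 := by positivity
    rw [← le_div_iff₀ hpos]
    exact csInf_le ⟨0, sparseQuotients_nonneg X k⟩ (quotient_mem hk hβ)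

lemma le_phiMax_mul {X : Matrix (Fin n) (Fin p) ℝ} {k : ℕ} {β : EuclideanSpace ℝ (Fin p)}
    (hk : l0 β ≤ k) : ‖meanVec X β‖ ^ 2 ≤ phiMax X k * ‖β‖ ^ 2 := by
  rcases eq_or_ne β 0 with rfl | hβ
  · simp [meanVec]
  · have hpos : 0 < ‖β‖ ^ 2 := by positivity
    rw [← div_le_iff₀ hpos]
    exact le_csSup (bddAbove_sparseQuotients X k) (quotient_mem hk hβ)

/-- Separates the degenerate case, where the lower bounds are trivial (division by zero gives `0`),
from the case where both eigenvalues may be divided by. -/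
lemma tau_eq_zero_or_pos (X : Matrix (Fin n) (Fin p) ℝ) (k : ℕ) :
    tau X k = 0 ∨ 0 < phiMin X k ∧ 0 < phiMax X k := by
  rcases (phiMin_nonneg X k).eq_or_lt with h | h
  · exact Or.inl (by rw [tau, ← h, zero_div])
  rcases (phiMax_nonneg X k).eq_or_lt with h' | h'
  · exact Or.inl (by rw [tau, ← h', div_zero])
  exact Or.inr ⟨h, h'⟩

lemma tau_nonneg (X : Matrix (Fin n) (Fin p) ℝ) (k : ℕ) : 0 ≤ tau X k :=
  div_nonneg (phiMin_nonneg X k) (phiMax_nonneg X k)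

lemma risk_eq (X : Matrix (Fin n) (Fin p) ℝ) (σ : ℝ)
    (est : EuclideanSpace ℝ (Fin n) → EuclideanSpace ℝ (Fin n)) (β : EuclideanSpace ℝ (Fin p)) :
    risk X σ est β =
      ∫⁻ y, ENNReal.ofReal (‖est y - meanVec X β‖ ^ 2) ∂(gaussLaw σ (meanVec X β)) := rfl

lemma le_minimaxRisk {X : Matrix (Fin n) (Fin p) ℝ} {σ : ℝ} {Ω : Finset (Finset (Fin p))} {k : ℕ}
    {b : ℝ≥0∞} (h : ∀ est : EuclideanSpace ℝ (Fin n) → EuclideanSpace ℝ (Fin n), Measurable est →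
      ∃ β ∈ admissibleCoeffs Ω k, b ≤ risk X σ est β) : b ≤ minimaxRisk X σ Ω k := by
  refine le_iInf₂ fun est hest => ?_
  obtain ⟨β, hβ, hle⟩ := h est hest
  exact hle.trans (le_iSup₂ (f := fun β _ => risk X σ est β) β hβ)

lemma mem_modelsUpTo {Ω : Finset (Finset (Fin p))} {M : Finset (Fin p)} {k : ℕ}
    (hM : M ∈ modelsOfSize Ω k) : M ∈ modelsUpTo Ω k :=
  Finset.mem_biUnion.2 ⟨k, by simp, hM⟩

lemma l0_le_card {β : EuclideanSpace ℝ (Fin p)} {M : Finset (Fin p)}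
    (h : ∀ j, j ∉ M → β j = 0) : l0 β ≤ M.card := by
  refine Finset.card_le_card fun j hj => ?_
  by_contra hjM
  exact (Finset.mem_filter.1 hj).2 (h j hjM)

/-! ### The parametric bound from a single model -/

/-- Extension by zero of coefficients indexed by a model. -/
def extendCoeffs (M : Finset (Fin p)) : EuclideanSpace ℝ M →ₗ[ℝ] EuclideanSpace ℝ (Fin p) where
  toFun v := WithLp.toLp 2 fun j => if h : j ∈ M then v ⟨j, h⟩ else 0
  map_add' u v := by
    ext j
    by_cases h : j ∈ M <;> simp [h]
  map_smul' r v := by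
    ext j
    by_cases h : j ∈ M <;> simp [h]

lemma extendCoeffs_of_mem {M : Finset (Fin p)} (v : EuclideanSpace ℝ M) {j : Fin p} (h : j ∈ M) :
    extendCoeffs M v j = v ⟨j, h⟩ := dif_pos h

lemma extendCoeffs_of_notMem {M : Finset (Fin p)} (v : EuclideanSpace ℝ M) {j : Fin p}
    (h : j ∉ M) : extendCoeffs M v j = 0 := dif_neg h

lemma norm_extendCoeffs_sq {M : Finset (Fin p)} (v : EuclideanSpace ℝ M) :
    ‖extendCoeffs M v‖ ^ 2 = ‖v‖ ^ 2 := by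
  rw [EuclideanSpace.real_norm_sq_eq, EuclideanSpace.real_norm_sq_eq,
    ← Finset.sum_subset (Finset.subset_univ M)
      (fun j _ h => by rw [extendCoeffs_of_notMem v h, sq, zero_mul]),
    ← Finset.sum_coe_sort M]
  exact Finset.sum_congr rfl fun j _ => by rw [extendCoeffs_of_mem v j.2]

/-- The parametric lower bound given by a single model. -/
lemma tau_mul_card_le_minimaxRisk {X : Matrix (Fin n) (Fin p) ℝ} {σ : ℝ} (hσ : 0 < σ)
    {Ω : Finset (Finset (Fin p))} {M : Finset (Fin p)} {k : ℕ} (hM : M ∈ modelsOfSize Ω k) :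
    ENNReal.ofReal (σ ^ 2 * (tau X k * k) / 32) ≤ minimaxRisk X σ Ω k := by
  have hcard : M.card = k := (Finset.mem_filter.1 hM).2
  rcases tau_eq_zero_or_pos X k with h0 | ⟨hmin, hmax⟩
  · simp [h0]
  refine le_minimaxRisk fun est hest => ?_
  -- Flipping a sign moves the mean by at most `φ_max · 4 a² = σ² / 2` in squared norm. As `a ≠ 0`,
  -- every vertex has support exactly `M`.
  set a := Real.sqrt (σ ^ 2 / (8 * phiMax X k)) with ha
  have ha0 : 0 < a := Real.sqrt_pos.2 (by positivity)
  have ha2 : a ^ 2 = σ ^ 2 / (8 * phiMax X k) := Real.sq_sqrt (by positivity)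
  have hl0 : ∀ v, l0 (extendCoeffs M v) ≤ k := fun v =>
    hcard ▸ l0_le_card fun j hj => extendCoeffs_of_notMem v hj
  obtain ⟨ω, hω⟩ := exists_risk_ge_of_cube hσ ha0.le hmin
    (Matrix.toEuclideanLin X ∘ₗ extendCoeffs M)
    (fun v => by rw [← norm_extendCoeffs_sq v]; exact phiMin_mul_le (hl0 v))
    (fun v hv => by
      have h1 : ‖meanVec X (extendCoeffs M v)‖ ^ 2 ≤ phiMax X k * ‖extendCoeffs M v‖ ^ 2 :=
        le_phiMax_mul (hl0 v)
      rw [norm_extendCoeffs_sq, hv, ha2] at h1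
      rw [div_le_iff₀ (by positivity)]
      refine h1.trans (le_of_eq ?_)
      field_simp
      norm_num) hest
  refine ⟨extendCoeffs M (cubeVertex a ω), ⟨M, mem_modelsUpTo hM, fun j => ?_⟩, ?_⟩
  · constructor
    · intro h
      by_contra hj
      exact h (extendCoeffs_of_notMem _ hj)
    · intro h
      rw [extendCoeffs_of_mem _ h]
      cases hb : ω ⟨j, h⟩ <;> simp [cubeVertex, hb, ha0.ne']
  · rw [risk_eq]
    refine le_trans (le_of_eq ?_) hω
    rw [Fintype.card_coe, hcard, ha2, tau]
    congr 1
    field_simp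
    ring

/-! ### The entropy bound from many models -/

/-- The coefficient vector with constant value `a` on the model `M`. -/
def constCoeffs (a : ℝ) (M : Finset (Fin p)) : EuclideanSpace ℝ (Fin p) :=
  WithLp.toLp 2 fun j => if j ∈ M then a else 0

lemma constCoeffs_ne_zero_iff {a : ℝ} (ha : a ≠ 0) (M : Finset (Fin p)) (j : Fin p) :
    constCoeffs a M j ≠ 0 ↔ j ∈ M := by
  simp [constCoeffs, ha]

lemma norm_constCoeffs_sub_sq (a : ℝ) (M M' : Finset (Fin p)) :
    ‖constCoeffs a M - constCoeffs a M'‖ ^ 2 = a ^ 2 * (symmDiff M M').card := by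
  rw [EuclideanSpace.real_norm_sq_eq, mul_comm, ← nsmul_eq_mul, ← Finset.sum_const,
    ← Finset.sum_subset (Finset.subset_univ (symmDiff M M'))]
  · refine Finset.sum_congr rfl fun j hj => ?_
    rcases Finset.mem_symmDiff.1 hj with ⟨h1, h2⟩ | ⟨h1, h2⟩ <;> simp [constCoeffs, h1, h2]
  · intro j _ hj
    rw [Finset.mem_symmDiff] at hj
    by_cases h1 : j ∈ M <;> by_cases h2 : j ∈ M' <;> simp [constCoeffs, h1, h2] <;> tauto

lemma l0_constCoeffs_sub_le {k : ℕ} (a : ℝ) {M M' : Finset (Fin p)} (hM : M.card = k)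
    (hM' : M'.card = k) : l0 (constCoeffs a M - constCoeffs a M') ≤ 2 * k := by
  refine (l0_le_card (M := M ∪ M') fun j hj => ?_).trans
    ((Finset.card_union_le M M').trans (by omega))
  rw [Finset.mem_union, not_or] at hj
  simp [constCoeffs, hj.1, hj.2]

/-- The lower bound given by the entropy of the set of admissible models. -/
lemma tau_mul_log_le_minimaxRisk (X : Matrix (Fin n) (Fin p) ℝ) {σ : ℝ} (hσ : 0 < σ)
    {Ω : Finset (Finset (Fin p))} {k : ℕ} (hk : 1 ≤ k) (hm : 1 ≤ numModels Ω k) :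
    ENNReal.ofReal (σ ^ 2 * (tau X (2 * k) * (Real.log (numModels Ω k) / max 1 (Real.log k))) / 512)
      ≤ minimaxRisk X σ Ω k := by
  rcases tau_eq_zero_or_pos X (2 * k) with h0 | ⟨hmin, hmax⟩
  · simp [h0]
  rcases hm.eq_or_lt with h1 | h1
  · simp [← h1]
  have hcard : ∀ M ∈ modelsOfSize Ω k, M.card = k := fun M hM => (Finset.mem_filter.1 hM).2
  have hJ : 0 < Nat.clog 2 (2 * k) := Nat.clog_pos one_lt_two (by omega)
  obtain ⟨j, M₀, hM₀, T, hTF, hball, hsep, hlog, hT⟩ :=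
    exists_local_packing (fun M M' : Finset (Fin p) => (symmDiff M M').card)
      (fun M M' => by rw [symmDiff_comm]) (fun M => by simp) (modelsOfSize Ω k)
      (Finset.card_pos.1 hm)
      (fun M hM M' hM' h => eq_of_card_eq_of_card_symmDiff_le_one
        ((hcard M hM).trans (hcard M' hM').symm) h)
      hJ.ne'
      (fun M hM M' hM' => by
        refine le_trans ?_ (Nat.le_pow_clog one_lt_two _)
        refine (Finset.card_le_card (symmDiff_le_sup (a := M) (b := M'))).trans
          ((Finset.card_union_le M M').trans ?_)
        rw [hcard M hM, hcard M' hM']; omega)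
  change Real.log (numModels Ω k) / _ ≤ _ at hlog
  have hlogm : 0 < Real.log (numModels Ω k) := Real.log_pos (by exact_mod_cast h1)
  have hJ' : (0 : ℝ) < Nat.clog 2 (2 * k) := by exact_mod_cast hJ
  have hlogT : 0 < Real.log T.card := lt_of_lt_of_le (by positivity) hlog
  have hT2 : 2 ≤ T.card := by
    by_contra! h
    have : T.card = 1 := by have := Finset.card_pos.2 hT; omega
    simp [this] at hlogT
  set D : ℝ := 2 ^ (j + 1) with hD
  have hD0 : 0 < D := by positivity
  -- Makes `φ_max · a² · D = σ² log |T| / 2`, the largest squared radius that the many-point bound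
  -- allows.
  set a := Real.sqrt (σ ^ 2 * Real.log T.card / (2 * phiMax X (2 * k) * D)) with ha
  have ha0 : 0 < a := Real.sqrt_pos.2 (by positivity)
  have ha2 : a ^ 2 = σ ^ 2 * Real.log T.card / (2 * phiMax X (2 * k) * D) :=
    Real.sq_sqrt (by positivity)
  -- Here `4 ρ² = φ_min · a² · 2 ^ j`, because `D = 2 · 2 ^ j`.
  set ρ := Real.sqrt (phiMin X (2 * k) * a ^ 2 * D / 8) with hρ
  have hρ2 : ρ ^ 2 = phiMin X (2 * k) * a ^ 2 * D / 8 := Real.sq_sqrt (by positivity)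
  refine le_minimaxRisk fun est hest => ?_
  obtain ⟨M, hMT, hM⟩ := exists_risk_ge_of_separated hσ (Real.sqrt_nonneg _) T
    (fun M => meanVec X (constCoeffs a M)) (meanVec X (constCoeffs a M₀)) (ρ := ρ) hT2
    (fun M hM M' hM' hne => by
      rw [meanVec_sub]
      refine (pow_le_pow_iff_left₀ (by positivity) (norm_nonneg _) two_ne_zero).1 ?_
      refine le_trans ?_ (phiMin_mul_le (l0_constCoeffs_sub_le a (hcard M (hTF hM))
        (hcard M' (hTF hM'))))
      rw [norm_constCoeffs_sub_sq, mul_pow, hρ2]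
      have h2 : (2 : ℝ) ^ j ≤ (symmDiff M M').card := by
        exact_mod_cast (hsep M hM M' hM' hne).le
      have h3 : D = 2 * 2 ^ j := by rw [hD]; ring
      rw [h3]
      have h4 : phiMin X (2 * k) * a ^ 2 * 2 ^ j ≤
          phiMin X (2 * k) * a ^ 2 * (symmDiff M M').card := by gcongr
      linarith)
    (fun M hM => by
      have h2 := le_phiMax_mul (X := X) (l0_constCoeffs_sub_le a (hcard M (hTF hM))
        (hcard M₀ hM₀))
      rw [meanVec_sub, div_le_iff₀ (by positivity)]
      refine h2.trans ?_
      rw [norm_constCoeffs_sub_sq]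
      have h3 : ((symmDiff M M₀).card : ℝ) ≤ D := by
        rw [symmDiff_comm, hD]; exact_mod_cast hball M hM
      calc phiMax X (2 * k) * (a ^ 2 * (symmDiff M M₀).card)
          ≤ phiMax X (2 * k) * (a ^ 2 * D) := by gcongr
        _ = Real.log T.card / 2 * σ ^ 2 := by rw [ha2]; field_simp) hest
  refine ⟨constCoeffs a M, ⟨M, mem_modelsUpTo (hTF hMT), constCoeffs_ne_zero_iff ha0.ne' M⟩, ?_⟩
  rw [risk_eq]
  refine le_trans (ENNReal.ofReal_le_ofReal ?_) hM
  have h5 : ρ ^ 2 / 8 = σ ^ 2 * (tau X (2 * k) * Real.log T.card) / 128 := by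
    rw [hρ2, ha2, tau]; field_simp; norm_num
  have h6 : Real.log (numModels Ω k) / max 1 (Real.log k) ≤ 4 * Real.log T.card := by
    rw [div_le_iff₀ hJ'] at hlog
    have h7 := clog_two_mul_le hk
    rw [div_le_iff₀ (by positivity)]
    calc _ ≤ Real.log T.card * (4 * max 1 (Real.log k)) := hlog.trans (by gcongr)
      _ = _ := by ring
  have h8 : σ ^ 2 * (tau X (2 * k) * (Real.log (numModels Ω k) / max 1 (Real.log k))) ≤
      σ ^ 2 * (tau X (2 * k) * (4 * Real.log T.card)) := by
    have := tau_nonneg X (2 * k)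
    gcongr
  rw [h5]
  linarith

end SparseRegression

theorem theorem2 :
    ∃ C : ℝ, 0 < C ∧
      ∀ (n p : ℕ) (X : Matrix (Fin n) (Fin p) ℝ) (σ : ℝ) (Ω : Finset (Finset (Fin p))) (p₀ : ℕ),
        0 < σ →
        (∀ S : Finset (Fin p), S.card = X.rank →
          LinearIndependent ℝ (fun j : S => X.col (j : Fin p))) →
        1 ≤ p₀ → p₀ ≤ X.rank →
        1 ≤ SparseRegression.numModels Ω p₀ →
        (2 * p₀ ≤ X.rank →
          ENNReal.ofReal (C * σ ^ 2 *
              max (SparseRegression.tau X (2 * p₀) *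
                    (Real.log (SparseRegression.numModels Ω p₀ : ℝ) / max 1 (Real.log (p₀ : ℝ))))
                  (SparseRegression.tau X p₀ * (p₀ : ℝ)))
            ≤ SparseRegression.minimaxRisk X σ Ω p₀) ∧
        (X.rank ≤ 2 * p₀ →
          ENNReal.ofReal (C * σ ^ 2 * (SparseRegression.tau X p₀ * (X.rank : ℝ)))
            ≤ SparseRegression.minimaxRisk X σ Ω p₀) := by
  -- The entropy bound dictates the constant: `1 / 128` from the packing, times `1 / 4` from the
  -- number of scales.
  refine ⟨1 / 512, by norm_num, fun n p X σ Ω p₀ hσ _ hp₀ _ hm => ?_⟩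
  obtain ⟨M, hM⟩ := Finset.card_pos.1 hm
  have hmodel := SparseRegression.tau_mul_card_le_minimaxRisk (X := X) hσ hM
  have hτ := SparseRegression.tau_nonneg X p₀
  refine ⟨fun _ => ?_, fun hr => ?_⟩
  · rcases max_choice (SparseRegression.tau X (2 * p₀) *
        (Real.log (SparseRegression.numModels Ω p₀ : ℝ) / max 1 (Real.log (p₀ : ℝ))))
        (SparseRegression.tau X p₀ * (p₀ : ℝ)) with h | h
    · rw [h]
      refine le_trans (le_of_eq ?_)
        (SparseRegression.tau_mul_log_le_minimaxRisk X hσ hp₀ hm)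
      congr 1
      ring
    · rw [h]
      refine le_trans (ENNReal.ofReal_le_ofReal ?_) hmodel
      have : 0 ≤ σ ^ 2 * (SparseRegression.tau X p₀ * (p₀ : ℝ)) := by positivity
      linarith
  · refine le_trans (ENNReal.ofReal_le_ofReal ?_) hmodel
    have hr' : (X.rank : ℝ) ≤ 2 * p₀ := by exact_mod_cast hr
    have h1 : σ ^ 2 * (SparseRegression.tau X p₀ * (X.rank : ℝ)) ≤
        σ ^ 2 * (SparseRegression.tau X p₀ * (2 * p₀)) := by gcongr
    have : 0 ≤ σ ^ 2 * (SparseRegression.tau X p₀ * (p₀ : ℝ)) := by positivity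
    linarith
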